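/- Let $K$ be an algebraically closed field and let $\Gamma$ be the quiver with vertices $e_i$ ($i\in\mathbb{Z}/4$) and eight arrows $a_{l,m}\colon e_m\to e_{m+1}$ ($l\in\mathbb{Z}/2$, $m\in\mathbb{Z}/4$). In the path algebra $K\Gamma$ (paths are written from left to right, and $e_i$ also denotes the trivial path at the vertex $e_i$) put $x_l=\sum_{m\in\mathbb{Z}/4}a_{l,m}$ for $l\in\mathbb{Z}/2$. For $q_0,q_1,q_2,q_3\in K\setminus\{0\}$ let $A=A_0(q_0,q_1,q_2,q_3)$ be the quotient of $K\Gamma$ by the two-sided ideal generated by the elements $$x_lx_{l+1}\quad(l\in\mathbb{Z}/2),\qquad e_i\bigl(q_ix_i^{2}+x_{i+1}^{2}\bigr)\quad(i\in\mathbb{Z}/4),$$ where the subscripts of $x$ are read modulo $2$. Then, for all nonzero $q_0,q_1,q_2,q_3$, the algebra $A$ is a self-injective Koszul algebra. That is: 1. $A$ is finite-dimensional over $K$, and it is injective as a right and as a left module over itself; 2. $A$ is graded by path length, $A=\bigoplus_{k\ge0}A_k$ with $A_k$ the image of the span of the paths of length $k$; its degree-zero part $A_0$ is semisimple; and, with $\operatorname{rad}A$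 the Jacobson radical of $A$, the graded right $A$-module $A/\operatorname{rad}A$ has a linear resolution, i.e. an exact sequence $\cdots\to P^2\to P^1\to P^0\to A/\operatorname{rad}A\to0$ of graded right $A$-modules and degree-$0$ homomorphisms in which each $P^n$ is projective and generated in degree $n$. -/

import Mathlib

open MulOpposite

universe u v w

noncomputable section

/-! ### Path algebras -/

/-- The path algebra `K Q` of a quiver `Q` with vertex set `V`: the `K`-vector space with basis all
(oriented) paths, the trivial paths included. -/
def PathAlgebra (K : Type u) [Field K] (V : Type v) [Quiver.{w} V] : Type (max u v w) :=
  (Σ a b : V, Quiver.Path a b) →₀ K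

namespace PathAlgebra

section Basic

variable (K : Type u) [Field K] {V : Type v} [Quiver.{w} V]

instance : AddCommGroup (PathAlgebra K V) :=
  inferInstanceAs (AddCommGroup ((Σ a b : V, Quiver.Path a b) →₀ K))

instance : Module K (PathAlgebra K V) :=
  inferInstanceAs (Module K ((Σ a b : V, Quiver.Path a b) →₀ K))

/-- The basis of the path algebra that consists of all paths. -/
def pathBasis (V : Type v) [Quiver.{w} V] :
    Module.Basis (Σ a b : V, Quiver.Path a b) K (PathAlgebra K V) :=
  Module.Basis.ofRepr (LinearEquiv.refl K ((Σ a b : V, Quiver.Path a b) →₀ K))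

/-- The basis element of the path algebra given by a path. -/
def ofPath {a b : V} (p : Quiver.Path a b) : PathAlgebra K V := pathBasis K V ⟨a, b, p⟩

/-- The trivial path `e_a` at the vertex `a`. -/
def vertex (a : V) : PathAlgebra K V := ofPath K (Quiver.Path.nil : Quiver.Path a a)

/-- An arrow, as an element of the path algebra. -/
def arrow {a b : V} (f : a ⟶ b) : PathAlgebra K V := ofPath K f.toPath

/-- The linear span of the paths of length `n`. -/
def lengthComponent (V : Type v) [Quiver.{w} V] (n : ℕ) : Submodule K (PathAlgebra K V) :=
  Submodule.span K {x | ∃ (a b : V) (p : Quiver.Path a b), p.length = n ∧ x = ofPath K p}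

@[elab_as_elim]
theorem induction_on {P : PathAlgebra K V → Prop} (x : PathAlgebra K V) (h0 : P 0)
    (hadd : ∀ x y, P x → P y → P (x + y))
    (hpath : ∀ (c : K) {a b : V} (p : Quiver.Path a b), P (c • ofPath K p)) : P x := by
  rw [← (pathBasis K V).linearCombination_repr x, Finsupp.linearCombination_apply, Finsupp.sum]
  exact Finset.sum_induction _ P hadd h0 fun p _ => hpath _ p.2.2

instance [Fintype V] : One (PathAlgebra K V) := ⟨∑ a : V, vertex K a⟩

theorem one_def [Fintype V] : (1 : PathAlgebra K V) = ∑ a : V, vertex K a := rfl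

end Basic

section Ring

variable (K : Type u) [Field K] {V : Type v} [Quiver.{w} V] [DecidableEq V]

/-- The product of two paths (written from left to right): their concatenation if the first one ends
where the second one starts, and `0` otherwise. -/
def pathMul (p q : Σ a b : V, Quiver.Path a b) : PathAlgebra K V :=
  if h : p.2.1 = q.1 then ofPath K ((p.2.2.cast rfl h).comp q.2.2) else 0

/-- The bilinear extension of `pathMul`. -/
def mulLin : PathAlgebra K V →ₗ[K] PathAlgebra K V →ₗ[K] PathAlgebra K V :=
  (pathBasis K V).constr K fun p => (pathBasis K V).constr K fun q => pathMul K p q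

instance : Mul (PathAlgebra K V) := ⟨fun x y => mulLin K x y⟩

theorem mul_def (x y : PathAlgebra K V) : x * y = mulLin K x y := rfl

theorem ofPath_mul_ofPath {a b c d : V} (p : Quiver.Path a b) (q : Quiver.Path c d) :
    ofPath K p * ofPath K q =
      if h : b = c then ofPath K ((p.cast rfl h).comp q) else 0 := by
  rw [mul_def, mulLin, ofPath, ofPath, Module.Basis.constr_basis, Module.Basis.constr_basis]
  rfl

theorem ofPath_mul_ofPath_same {a b c : V} (p : Quiver.Path a b) (q : Quiver.Path b c) :
    ofPath K p * ofPath K q = ofPath K (p.comp q) := by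
  rw [ofPath_mul_ofPath, dif_pos rfl]; rfl

theorem ofPath_mul_ofPath_ne {a b c d : V} (p : Quiver.Path a b) (q : Quiver.Path c d)
    (h : b ≠ c) : ofPath K p * ofPath K q = 0 := by
  rw [ofPath_mul_ofPath, dif_neg h]

theorem add_mul_aux (x y z : PathAlgebra K V) : (x + y) * z = x * z + y * z := by
  simp [mul_def]

theorem mul_add_aux (x y z : PathAlgebra K V) : x * (y + z) = x * y + x * z := by
  simp [mul_def]

theorem zero_mul_aux (x : PathAlgebra K V) : 0 * x = 0 := by simp [mul_def]

theorem mul_zero_aux (x : PathAlgebra K V) : x * 0 = 0 := by simp [mul_def]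

theorem smul_mul_aux (c : K) (x y : PathAlgebra K V) : (c • x) * y = c • (x * y) := by
  simp [mul_def]

theorem mul_smul_aux (c : K) (x y : PathAlgebra K V) : x * (c • y) = c • (x * y) := by
  simp [mul_def]

theorem mul_assoc_aux (x y z : PathAlgebra K V) : x * y * z = x * (y * z) := by
  induction x using induction_on with
  | h0 => simp only [zero_mul_aux]
  | hadd _ _ h₁ h₂ => simp only [add_mul_aux, h₁, h₂]
  | hpath c p =>
  induction y using induction_on with
  | h0 => simp only [zero_mul_aux, mul_zero_aux]
  | hadd _ _ h₁ h₂ => simp only [add_mul_aux, mul_add_aux, h₁, h₂]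
  | hpath c' p' =>
  induction z using induction_on with
  | h0 => simp only [mul_zero_aux]
  | hadd _ _ h₁ h₂ => simp only [mul_add_aux, h₁, h₂]
  | hpath c'' p'' =>
  rename_i a b a' b' a'' b''
  simp only [smul_mul_aux, mul_smul_aux]
  congr 3
  by_cases h : b = a'
  · subst h
    by_cases h' : b' = a''
    · subst h'
      simp only [ofPath_mul_ofPath_same, Quiver.Path.comp_assoc]
    · simp only [ofPath_mul_ofPath_same, ofPath_mul_ofPath_ne K _ _ h', mul_zero_aux]
  · by_cases h' : b' = a''
    · subst h'
      simp only [ofPath_mul_ofPath_same, ofPath_mul_ofPath_ne K _ _ h, zero_mul_aux]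
    · simp only [ofPath_mul_ofPath_ne K _ _ h, ofPath_mul_ofPath_ne K _ _ h', zero_mul_aux,
        mul_zero_aux]

variable [Fintype V]

theorem one_mul_aux (x : PathAlgebra K V) : 1 * x = x := by
  induction x using induction_on with
  | h0 => exact mul_zero_aux K 1
  | hadd _ _ h₁ h₂ => simp only [mul_add_aux, h₁, h₂]
  | hpath c p =>
  rename_i a b
  rw [mul_smul_aux]
  congr 1
  rw [mul_def, one_def, map_sum, LinearMap.sum_apply, Finset.sum_eq_single a]
  · rw [← mul_def, vertex, ofPath_mul_ofPath_same, Quiver.Path.nil_comp]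
  · intro a' _ h
    rw [← mul_def, vertex, ofPath_mul_ofPath_ne K _ _ h]
  · simp

theorem mul_one_aux (x : PathAlgebra K V) : x * 1 = x := by
  induction x using induction_on with
  | h0 => exact zero_mul_aux K 1
  | hadd _ _ h₁ h₂ => simp only [add_mul_aux, h₁, h₂]
  | hpath c p =>
  rename_i a b
  rw [smul_mul_aux]
  congr 1
  rw [mul_def, one_def, map_sum, Finset.sum_eq_single b]
  · rw [← mul_def, vertex, ofPath_mul_ofPath_same, Quiver.Path.comp_nil]
  · intro b' _ h
    rw [← mul_def, vertex, ofPath_mul_ofPath_ne K _ _ h.symm]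
  · simp

instance : Ring (PathAlgebra K V) :=
  { (inferInstance : AddCommGroup (PathAlgebra K V)) with
    mul := (· * ·)
    one := 1
    left_distrib := mul_add_aux K
    right_distrib := add_mul_aux K
    zero_mul := zero_mul_aux K
    mul_zero := mul_zero_aux K
    mul_assoc := mul_assoc_aux K
    one_mul := one_mul_aux K
    mul_one := mul_one_aux K }

instance : Algebra K (PathAlgebra K V) :=
  Algebra.ofModule (smul_mul_aux K) (fun c x y => mul_smul_aux K c x y)

end Ring

end PathAlgebra

/-! ### Self-injective algebras and Koszul algebras -/

/-- A self-injective `K`-algebra: a finite-dimensional algebra that is injective as a right module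
and as a left module over itself. Right `A`-modules are modules over `Aᵐᵒᵖ`. -/
structure IsSelfInjectiveAlgebra (K : Type u) [Field K] (A : Type u) [Ring A] [Algebra K A] :
    Prop where
  finiteDimensional : FiniteDimensional K A
  injective_right : Module.Injective Aᵐᵒᵖ A
  injective_left : Module.Injective A A

section Koszul

variable {K : Type u} [Field K] {A : Type u} [Ring A] [Algebra K A]

/-- `𝓟` is a grading of the right `A`-module `P` by `ℕ`, compatible with the grading `𝒜` of `A`:
`P = ⨁ₖ 𝓟 k`, and `𝓟 k · 𝒜 l ⊆ 𝓟 (k + l)`. -/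
structure IsGradedRightModule (𝒜 : ℕ → Submodule K A) {P : Type u} [AddCommGroup P]
    [Module Aᵐᵒᵖ P] (𝓟 : ℕ → AddSubgroup P) : Prop where
  isInternal : DirectSum.IsInternal 𝓟
  smul_mem : ∀ (k l : ℕ) (p : P) (a : A), p ∈ 𝓟 k → a ∈ 𝒜 l → op a • p ∈ 𝓟 (k + l)

/-- The right `A`-module `A / rad A`, where `rad A` is the Jacobson radical of `A`: the
intersection of all maximal right ideals. -/
abbrev TopOfAlgebra (A : Type u) [Ring A] : Type u := A ⧸ Module.jacobson Aᵐᵒᵖ A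

/-- The complex `⋯ → P 2 → P 1 → P 0 → A / rad A → 0` of right `A`-modules, with differentials
`d n : P (n + 1) → P n` and augmentation `ε`, is a linear resolution of `A / rad A` over the graded
algebra `A = ⨁ₖ 𝒜 k`: it is an exact sequence of graded modules and homomorphisms of degree `0`
(`A / rad A` has the grading induced from `A`), and `P n` is projective and generated in
degree `n`. -/
structure IsLinearResolution (𝒜 : ℕ → Submodule K A) (P : ℕ → Type u)
    [∀ n, AddCommGroup (P n)] [∀ n, Module Aᵐᵒᵖ (P n)] (𝓟 : ∀ n, ℕ → AddSubgroup (P n))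
    (d : ∀ n, P (n + 1) →ₗ[Aᵐᵒᵖ] P n) (ε : P 0 →ₗ[Aᵐᵒᵖ] TopOfAlgebra A) : Prop where
  projective : ∀ n, Module.Projective Aᵐᵒᵖ (P n)
  graded : ∀ n, IsGradedRightModule 𝒜 (𝓟 n)
  d_mem : ∀ n k, ∀ p ∈ 𝓟 (n + 1) k, d n p ∈ 𝓟 n k
  ε_mem : ∀ k, ∀ p ∈ 𝓟 0 k, ∃ a ∈ 𝒜 k, ε p = Submodule.Quotient.mk a
  exact : ∀ n, Function.Exact (d (n + 1)) (d n)
  exact_zero : Function.Exact (d 0) ε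
  surjective : Function.Surjective ε
  generated : ∀ n, Submodule.span Aᵐᵒᵖ (𝓟 n n : Set (P n)) = ⊤

/-- A (finite-dimensional) algebra `A` with a family `𝒜` of subspaces is a Koszul algebra:
`A = ⨁ₖ 𝒜 k` is a graded algebra, `𝒜 0` is a semisimple ring, and the right `A`-module `A / rad A`
has a linear resolution. If `A` is finite-dimensional and `𝒜 0` is semisimple then
`rad A = ⨁_{k ≥ 1} 𝒜 k`, so `A / rad A` is `𝒜 0` in degree `0`. -/
def IsKoszulAlgebra (𝒜 : ℕ → Submodule K A) : Prop :=
  FiniteDimensional K A ∧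
  (∃ _ : GradedAlgebra 𝒜, IsSemisimpleRing (𝒜 0)) ∧
  ∃ (P : ℕ → Type u) (_ : ∀ n, AddCommGroup (P n)) (_ : ∀ n, Module Aᵐᵒᵖ (P n))
    (𝓟 : ∀ n, ℕ → AddSubgroup (P n)) (d : ∀ n, P (n + 1) →ₗ[Aᵐᵒᵖ] P n)
    (ε : P 0 →ₗ[Aᵐᵒᵖ] TopOfAlgebra A), IsLinearResolution 𝒜 P 𝓟 d ε

end Koszul

/-! ### The quiver `Γ` and the algebras `A_T(q₀, q₁, q₂, q₃)` -/

/-- The vertices `e₀, e₁, e₂, e₃` of the quiver `Γ`. -/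
abbrev GammaVertex : Type := ZMod 4

/-- The arrows of `Γ`: for `l ∈ ℤ/2` and `m ∈ ℤ/4` an arrow `a_{l,m}` from `e_m` to `e_{m+1}`. -/
inductive GammaArrow : GammaVertex → GammaVertex → Type
  | a (l : ZMod 2) (m : GammaVertex) : GammaArrow m (m + 1)

instance gammaQuiver : Quiver GammaVertex := ⟨GammaArrow⟩

namespace Gamma

variable (K : Type u) [Field K]

/-- The path algebra `KΓ`. -/
abbrev KGamma : Type u := PathAlgebra K GammaVertex

/-- The trivial path `e_i`. -/
def e (i : ZMod 4) : KGamma K := PathAlgebra.vertex K (V := GammaVertex) i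

/-- `x_l = ∑_m a_{l,m}`. -/
def x (l : ZMod 2) : KGamma K :=
  ∑ m : ZMod 4, PathAlgebra.arrow K (V := GammaVertex) (GammaArrow.a l m)

/-- Reduction of subscripts from modulo `4` to modulo `2`. -/
def mod2 (i : ZMod 4) : ZMod 2 := ((i.val : ℕ) : ZMod 2)

variable {K}

/-- The generators `x_l x_{l+1}` and `e_i (q_i x_i^{4T+2} + x_{i+1}^{4T+2})` of
`I_T(q₀, q₁, q₂, q₃)`. -/
def relations (T : ℕ) (q : ZMod 4 → K) : Set (KGamma K) :=
  {r | ∃ l : ZMod 2, r = x K l * x K (l + 1)} ∪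
  {r | ∃ i : ZMod 4,
    r = e K i * (q i • x K (mod2 i) ^ (4 * T + 2) + x K (mod2 i + 1) ^ (4 * T + 2))}

/-- The two-sided ideal `I_T(q₀, q₁, q₂, q₃)` of `KΓ`. -/
def idealI (T : ℕ) (q : ZMod 4 → K) : TwoSidedIdeal (KGamma K) :=
  TwoSidedIdeal.span (relations T q)

/-- The algebra `A_T(q₀, q₁, q₂, q₃) = KΓ / I_T(q₀, q₁, q₂, q₃)`. -/
def AlgebraA (T : ℕ) (q : ZMod 4 → K) : Type u := KGamma K ⧸ (idealI T q).asIdeal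

instance (T : ℕ) (q : ZMod 4 → K) : Ring (AlgebraA T q) :=
  inferInstanceAs (Ring (KGamma K ⧸ (idealI T q).asIdeal))

instance (T : ℕ) (q : ZMod 4 → K) : Algebra K (AlgebraA T q) :=
  inferInstanceAs (Algebra K (KGamma K ⧸ (idealI T q).asIdeal))

/-- The canonical projection `KΓ → A_T(q₀, q₁, q₂, q₃)`. -/
def proj (T : ℕ) (q : ZMod 4 → K) : KGamma K →ₐ[K] AlgebraA T q :=
  Ideal.Quotient.mkₐ K (idealI T q).asIdeal

/-- The family of subspaces of `A_T(q₀, q₁, q₂, q₃)` given by path length: the `n`-th one is the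
image of the span of the paths of length `n`. -/
def lengthGrading (T : ℕ) (q : ZMod 4 → K) (n : ℕ) : Submodule K (AlgebraA T q) :=
  (PathAlgebra.lengthComponent K GammaVertex n).map (proj T q).toLinearMap

end Gamma

end

/-!
Since `eᵢ xₗ = xₗ eᵢ₊₁`, the algebra `A` is a skew algebra over `R = K⁴`: it is free over `R` with
basis `1, x₀, x₁, s`, where `s = ∑ᵢ eᵢ xᵢ²`, and `xₗ g = σ(g) xₗ` for the cyclic shift `σ` of `R`,
`xₗ xₗ₊₁ = 0` and `xₗ² = tₗ s` for units `tₗ` of `R` made of the entries `1` and `-qᵢ`.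
As the `tₗ` are units, the coefficient of `s` followed by the sum of the coordinates is a
nondegenerate Frobenius form, so `A` is self-injective. For a unit `α`, an element of the kernel of
`(pⱼ) ↦ (xₗ pⱼ + α xₗ₊₁ pⱼ₊₁)` has no constant terms, and its linear terms satisfy the
equations that describe the image of a map `(pⱼ) ↦ (xₗ₊₁ pⱼ + β xₗ pⱼ₊₁)` for another unit `β`. Such
maps therefore form a linear resolution `⋯ → A³ → A² → A` of `A / rad A`.
-/

noncomputable section

section FrobeniusForm

variable {K : Type u} [Field K]

theorem baer_self_of_frobeniusForm {A : Type v} [Ring A] [Algebra K A] [FiniteDimensional K A]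
    (τ : A →ₗ[K] K) (hτ : ∀ c, (∀ b, τ (b * c) = 0) → c = 0) : Module.Baer A A := by
  let Φ : A →ₗ[K] Module.Dual K A := (LinearMap.mul K A).flip.compr₂ τ
  have hΦ : Function.Injective Φ :=
    (injective_iff_map_eq_zero Φ).2 fun _ hc => hτ _ (LinearMap.congr_fun hc)
  have hΦ' : Function.Surjective Φ :=
    (LinearMap.injective_iff_surjective_of_finrank_eq_finrank Subspace.dual_finrank_eq.symm).1 hΦ
  intro I g
  obtain ⟨h, hh⟩ := LinearMap.exists_extend (p := I.restrictScalars K)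
    (τ ∘ₗ (g.restrictScalars K : I →ₗ[K] A))
  obtain ⟨c, rfl⟩ := hΦ' h
  have key (i : A) (hi : i ∈ I) : τ (i * c) = τ (g ⟨i, hi⟩) := LinearMap.congr_fun hh ⟨i, hi⟩
  refine ⟨LinearMap.toSpanSingleton A A c, fun i hi => sub_eq_zero.1 (hτ _ fun b => ?_)⟩
  have hb : g ⟨b * i, I.mul_mem_left b hi⟩ = b * g ⟨i, hi⟩ := g.map_smul b ⟨i, hi⟩
  rw [LinearMap.toSpanSingleton_apply, smul_eq_mul, mul_sub, map_sub, ← mul_assoc,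
    key _ (I.mul_mem_left b hi), hb, sub_self]

/-- The regular right module of a ring, as the regular left module of the opposite ring. -/
def unopRightLinearEquiv (A : Type v) [Ring A] : Aᵐᵒᵖ ≃ₗ[Aᵐᵒᵖ] A :=
  { opAddEquiv.symm with map_smul' := fun _ _ => rfl }

theorem isSelfInjectiveAlgebra_of_frobeniusForm {A : Type u} [Ring A] [Algebra K A]
    [FiniteDimensional K A] (τ : A →ₗ[K] K) (hl : ∀ c, (∀ b, τ (b * c) = 0) → c = 0)
    (hr : ∀ c, (∀ b, τ (c * b) = 0) → c = 0) : IsSelfInjectiveAlgebra K A where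
  finiteDimensional := inferInstance
  injective_left := (baer_self_of_frobeniusForm τ hl).injective
  injective_right :=
    have baer_op : Module.Baer Aᵐᵒᵖ Aᵐᵒᵖ :=
      baer_self_of_frobeniusForm (τ ∘ₗ (opLinearEquiv K).symm.toLinearMap) fun _ hc =>
        unop_injective (hr _ fun b => hc (op b))
    (baer_op.of_equiv (unopRightLinearEquiv A)).injective

section Transport

attribute [local instance] RingHomInvPair.of_ringEquiv

theorem IsSelfInjectiveAlgebra.of_algEquiv {A B : Type u} [Ring A] [Algebra K A] [Ring B]
    [Algebra K B] (φ : A ≃ₐ[K] B) (hA : IsSelfInjectiveAlgebra K A) :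
    IsSelfInjectiveAlgebra K B where
  finiteDimensional :=
    have := hA.finiteDimensional
    Module.Finite.equiv φ.toLinearEquiv
  injective_right :=
    have := hA.injective_right
    let φ' : A ≃ₛₗ[(φ.toRingEquiv.op : Aᵐᵒᵖ →+* Bᵐᵒᵖ)] B :=
      { φ.toAddEquiv with map_smul' := fun c a => map_mul φ a c.unop }
    Module.Injective.of_ringEquiv φ.toRingEquiv.op φ'
  injective_left :=
    have := hA.injective_left
    let φ' : A ≃ₛₗ[(φ.toRingEquiv : A →+* B)] B :=
      { φ.toAddEquiv with map_smul' := map_mul φ }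
    Module.Injective.of_ringEquiv φ.toRingEquiv φ'

end Transport

end FrobeniusForm

section Gradings

theorem isInternal_of_projections {ι M S : Type*} [DecidableEq ι] [AddCommGroup M]
    [SetLike S M] [AddSubgroupClass S M] (ℳ : ι → S) (π : ι → M →+ M)
    (mem : ∀ i m, π i m ∈ ℳ i) (same : ∀ i, ∀ m ∈ ℳ i, π i m = m)
    (ne : ∀ i j, j ≠ i → ∀ m ∈ ℳ j, π i m = 0) (sum : ∀ m, ∃ s : Finset ι, ∑ i ∈ s, π i m = m) :
    DirectSum.IsInternal ℳ := by
  have key (i : ι) (z : DirectSum ι fun i => ℳ i) :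
      π i (DirectSum.coeAddMonoidHom ℳ z) = z i := by
    induction z using DirectSum.induction_on with
    | zero => simp
    | of j m =>
      rw [DirectSum.coeAddMonoidHom_of]
      rcases eq_or_ne j i with rfl | h
      · rw [same _ _ m.2, DirectSum.of_eq_same]
      · rw [ne i j h _ m.2, DirectSum.of_eq_of_ne _ _ _ h.symm, ZeroMemClass.coe_zero]
    | add y z hy hz => rw [map_add, map_add, hy, hz, DirectSum.add_apply, AddMemClass.coe_add]
  refine ⟨(injective_iff_map_eq_zero _).2 fun z hz => ?_, fun m => ?_⟩
  · ext i
    rw [← key, hz, map_zero, DirectSum.zero_apply, ZeroMemClass.coe_zero]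
  · obtain ⟨s, hs⟩ := sum m
    refine ⟨∑ i ∈ s, DirectSum.of (fun i => ℳ i) i ⟨π i m, mem i m⟩, ?_⟩
    simp only [map_sum, DirectSum.coeAddMonoidHom_of, hs]

variable {K : Type u} [Field K] {A : Type u} [Ring A] [Algebra K A] (𝒜 : ℕ → Submodule K A)
  {ι : Type}

/-- The grading of the free right `A`-module `ι → A` whose basis vectors have degree `n`. -/
def freeGrading (ι : Type) (n k : ℕ) : AddSubgroup (ι → A) :=
  AddSubgroup.pi Set.univ fun _ => if n ≤ k then (𝒜 (k - n)).toAddSubgroup else ⊥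

variable {𝒜}

theorem mem_freeGrading_add {n k : ℕ} {p : ι → A} :
    p ∈ freeGrading 𝒜 ι n (n + k) ↔ ∀ j, p j ∈ 𝒜 k := by
  simp [freeGrading, AddSubgroup.mem_pi]

theorem mem_freeGrading {n k : ℕ} {p : ι → A} :
    p ∈ freeGrading 𝒜 ι n k ↔ p = 0 ∨ ∃ l, n + l = k ∧ ∀ j, p j ∈ 𝒜 l := by
  rcases lt_or_ge k n with h | h
  · have hne (l : ℕ) : n + l ≠ k := by omega
    simp [freeGrading, AddSubgroup.mem_pi, not_le.2 h, hne, funext_iff]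
  · obtain ⟨k, rfl⟩ := Nat.exists_eq_add_of_le h
    simp only [mem_freeGrading_add, Nat.add_left_cancel_iff, exists_eq_left, iff_or_self]
    rintro rfl _
    exact zero_mem _

variable (𝒜) in
theorem span_freeGrading_self [SetLike.GradedOne 𝒜] [Finite ι] (n : ℕ) :
    Submodule.span Aᵐᵒᵖ (freeGrading 𝒜 ι n n : Set (ι → A)) = ⊤ := by
  classical
  have := Fintype.ofFinite ι
  refine eq_top_iff.2 fun p _ => ?_
  have hp : p = ∑ j, op (p j) • (Pi.single j 1 : ι → A) := by
    ext j
    simp [Finset.sum_apply, Pi.single_apply]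
  rw [hp]
  refine Submodule.sum_mem _ fun j _ => Submodule.smul_mem _ _ (Submodule.subset_span ?_)
  refine (mem_freeGrading_add (k := 0)).2 fun i => ?_
  rcases eq_or_ne i j with rfl | h
  · rw [Pi.single_eq_same]
    exact SetLike.one_mem_graded 𝒜
  · rw [Pi.single_eq_of_ne h]
    exact zero_mem _

variable [GradedAlgebra 𝒜]

variable (𝒜) in
/-- The projection of the free right `A`-module `ι → A`, whose basis vectors have degree `n`, to
its homogeneous component of degree `k`. -/
def freeProj (ι : Type) (n k : ℕ) : (ι → A) →+ (ι → A) :=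
  if n ≤ k then (GradedRing.proj 𝒜 (k - n)).compLeft ι else 0

theorem freeProj_add (n k : ℕ) (p : ι → A) (j : ι) :
    freeProj 𝒜 ι n (n + k) p j = GradedRing.proj 𝒜 k (p j) := by
  simp [freeProj]

theorem freeProj_of_lt {n k : ℕ} (h : k < n) : freeProj 𝒜 ι n k = 0 :=
  if_neg (not_le.2 h)

theorem freeProj_mem (n k : ℕ) (p : ι → A) : freeProj 𝒜 ι n k p ∈ freeGrading 𝒜 ι n k := by
  rcases lt_or_ge k n with h | h
  · rw [freeProj_of_lt h]
    exact zero_mem _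
  · obtain ⟨k, rfl⟩ := Nat.exists_eq_add_of_le h
    refine mem_freeGrading_add.2 fun j => ?_
    rw [freeProj_add]
    exact SetLike.coe_mem _

theorem freeProj_of_mem (n k l : ℕ) {p : ι → A} (hp : p ∈ freeGrading 𝒜 ι n l) :
    freeProj 𝒜 ι n k p = if k = l then p else 0 := by
  rcases mem_freeGrading.1 hp with rfl | ⟨l, rfl, hl⟩
  · rw [map_zero, ite_self]
  · rcases lt_or_ge k n with h | h
    · rw [freeProj_of_lt h, if_neg (by omega), AddMonoidHom.zero_apply]
    · obtain ⟨k, rfl⟩ := Nat.exists_eq_add_of_le h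
      ext j
      rw [freeProj_add, GradedRing.proj_apply]
      split_ifs with hkl
      · rw [Nat.add_left_cancel hkl, DirectSum.decompose_of_mem_same 𝒜 (hl j)]
      · exact DirectSum.decompose_of_mem_ne 𝒜 (hl j) fun h => hkl (h ▸ rfl)

theorem exists_sum_freeProj_eq [Finite ι] (n : ℕ) (p : ι → A) :
    ∃ s : Finset ℕ, ∑ k ∈ s, freeProj 𝒜 ι n k p = p := by
  classical
  have := Fintype.ofFinite ι
  let s : Finset ℕ := Finset.univ.biUnion fun j => (DirectSum.decompose 𝒜 (p j)).support
  refine ⟨s.map (addLeftEmbedding n), funext fun j => ?_⟩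
  simp only [Finset.sum_map, addLeftEmbedding_apply, Finset.sum_apply, freeProj_add]
  have hj : (DirectSum.decompose 𝒜 (p j)).support ⊆ s :=
    Finset.subset_biUnion_of_mem (fun j => (DirectSum.decompose 𝒜 (p j)).support)
      (Finset.mem_univ j)
  refine (Finset.sum_subset hj fun i _ hi => ?_).symm.trans (DirectSum.sum_support_decompose 𝒜 _)
  rw [GradedRing.proj_apply, DFinsupp.notMem_support_iff.1 hi, ZeroMemClass.coe_zero]

theorem isGradedRightModule_freeGrading [Finite ι] (n : ℕ) :
    IsGradedRightModule 𝒜 (freeGrading 𝒜 ι n) where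
  isInternal :=
    isInternal_of_projections _ (freeProj 𝒜 ι n) (freeProj_mem n)
      (fun k _ hp => (freeProj_of_mem n k k hp).trans (if_pos rfl))
      (fun k l h _ hp => (freeProj_of_mem n k l hp).trans (if_neg h.symm))
      (exists_sum_freeProj_eq n)
  smul_mem k l p a hp ha := by
    rcases mem_freeGrading.1 hp with rfl | ⟨k, rfl, hk⟩
    · rw [smul_zero]
      exact zero_mem _
    · rw [add_assoc]
      exact mem_freeGrading_add.2 fun j => SetLike.mul_mem_graded (hk j) ha

theorem isLinearResolution_of_free {ι : ℕ → Type} [∀ n, Finite (ι n)] [Unique (ι 0)]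
    (d : ∀ n, (ι (n + 1) → A) →ₗ[Aᵐᵒᵖ] (ι n → A))
    (d_mem : ∀ n k p, (∀ j, p j ∈ 𝒜 k) → ∀ i, d n p i ∈ 𝒜 (1 + k))
    (exact : ∀ n, Function.Exact (d (n + 1)) (d n))
    (exact_zero : ∀ p, p default ∈ Module.jacobson Aᵐᵒᵖ A ↔ p ∈ Set.range (d 0)) :
    IsLinearResolution 𝒜 (fun n => ι n → A) (fun n => freeGrading 𝒜 (ι n) n) d
      ((Module.jacobson Aᵐᵒᵖ A).mkQ ∘ₗ LinearMap.proj default) where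
  projective n := Module.Projective.of_equiv
    (LinearEquiv.piCongrRight fun _ : ι n => unopRightLinearEquiv A)
  graded n := isGradedRightModule_freeGrading n
  d_mem n k p hp := by
    rcases mem_freeGrading.1 hp with rfl | ⟨k, rfl, hk⟩
    · rw [map_zero]
      exact zero_mem _
    · rw [add_assoc]
      exact mem_freeGrading_add.2 (d_mem n k p hk)
  ε_mem k p hp := by
    rw [← Nat.zero_add k, mem_freeGrading_add] at hp
    exact ⟨p default, hp default, rfl⟩
  exact := exact
  exact_zero p := (Submodule.Quotient.mk_eq_zero _).trans (exact_zero p)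
  surjective y := by
    obtain ⟨a, rfl⟩ := Submodule.Quotient.mk_surjective _ y
    exact ⟨fun _ => a, rfl⟩
  generated n := span_freeGrading_self 𝒜 n

end Gradings

section KoszulTransport

variable {K : Type u} [Field K] {A B : Type u} [Ring A] [Algebra K A] [Ring B] [Algebra K B]
  (𝒜 : ℕ → Submodule K A) (φ : A ≃ₐ[K] B)

/-- The family of subspaces `𝒜` carried over along the isomorphism `φ`. -/
def mapGrading (n : ℕ) : Submodule K B := (𝒜 n).map φ.toLinearMap

theorem gradedMonoid_mapGrading [SetLike.GradedMonoid 𝒜] :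
    SetLike.GradedMonoid (mapGrading 𝒜 φ) where
  one_mem := ⟨1, SetLike.one_mem_graded 𝒜, map_one φ⟩
  mul_mem := by
    rintro k l _ _ ⟨y, hy, rfl⟩ ⟨z, hz, rfl⟩
    exact ⟨y * z, SetLike.mul_mem_graded hy hz, map_mul φ y z⟩

theorem isInternal_mapGrading [GradedAlgebra 𝒜] : DirectSum.IsInternal (mapGrading 𝒜 φ) := by
  obtain ⟨indep, iSup_eq_top⟩ :=
    (DirectSum.isInternal_submodule_iff_iSupIndep_and_iSup_eq_top 𝒜).1
      (DirectSum.Decomposition.isInternal 𝒜)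
  refine (DirectSum.isInternal_submodule_iff_iSupIndep_and_iSup_eq_top _).2
    ⟨(iSupIndep_map_orderIso_iff (Submodule.orderIsoMapComap φ.toLinearEquiv)).2 indep, ?_⟩
  change ⨆ n, (𝒜 n).map φ.toLinearMap = ⊤
  rw [← Submodule.map_iSup, iSup_eq_top, Submodule.map_top, LinearMap.range_eq_top]
  exact φ.surjective

instance [GradedAlgebra 𝒜] : GradedAlgebra (mapGrading 𝒜 φ) :=
  { gradedMonoid_mapGrading 𝒜 φ, (isInternal_mapGrading 𝒜 φ).chooseDecomposition with }

instance [GradedAlgebra 𝒜] [IsSemisimpleRing (𝒜 0)] : IsSemisimpleRing (mapGrading 𝒜 φ 0) :=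
  let φ₀ : 𝒜 0 ≃+* mapGrading 𝒜 φ 0 :=
    { φ.toLinearEquiv.submoduleMap (𝒜 0) with
      map_mul' := fun y z => Subtype.ext (map_mul φ (y : A) z) }
  φ₀.isSemisimpleRing

variable {𝒜}

section Resolution

attribute [local instance] RingHomInvPair.of_ringEquiv

theorem map_mem_jacobson_iff {a : A} :
    φ a ∈ Module.jacobson Bᵐᵒᵖ B ↔ a ∈ Module.jacobson Aᵐᵒᵖ A := by
  let φ' : A ≃ₛₗ[(φ.toRingEquiv.op : Aᵐᵒᵖ →+* Bᵐᵒᵖ)] B :=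
    { φ.toAddEquiv with map_smul' := fun c a => map_mul φ a c.unop }
  rw [← Module.comap_jacobson_of_bijective φ'.bijective]
  rfl

/-- The isomorphism of the tops of isomorphic algebras. -/
def topEquiv : TopOfAlgebra A ≃+ TopOfAlgebra B :=
  QuotientAddGroup.congr _ _ φ.toAddEquiv <| by
    ext b
    exact ⟨fun ⟨a, ha, hab⟩ => hab ▸ (map_mem_jacobson_iff φ).2 ha, fun hb =>
      ⟨φ.symm b, (map_mem_jacobson_iff φ).1 (by simpa using hb), φ.apply_symm_apply b⟩⟩

theorem topEquiv_mk (a : A) :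
    topEquiv φ (Submodule.Quotient.mk a) = Submodule.Quotient.mk (φ a) := rfl

theorem topEquiv_smul (c : Bᵐᵒᵖ) (y : TopOfAlgebra A) :
    topEquiv φ (φ.toRingEquiv.symm.op c • y) = c • topEquiv φ y := by
  obtain ⟨a, rfl⟩ := Submodule.Quotient.mk_surjective _ y
  rw [← Submodule.Quotient.mk_smul, topEquiv_mk, topEquiv_mk, ← Submodule.Quotient.mk_smul]
  congr 1
  simp [MulOpposite.smul_eq_mul_unop]

theorem IsLinearResolution.map {P : ℕ → Type u} [∀ n, AddCommGroup (P n)]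
    [∀ n, Module Aᵐᵒᵖ (P n)] [∀ n, Module Bᵐᵒᵖ (P n)] {𝓟 : ∀ n, ℕ → AddSubgroup (P n)}
    {d : ∀ n, P (n + 1) →ₗ[Aᵐᵒᵖ] P n} {ε : P 0 →ₗ[Aᵐᵒᵖ] TopOfAlgebra A}
    (h : IsLinearResolution 𝒜 P 𝓟 d ε)
    (smul_eq : ∀ n (b : Bᵐᵒᵖ) (p : P n), b • p = φ.toRingEquiv.symm.op b • p) :
    IsLinearResolution (mapGrading 𝒜 φ) P 𝓟
      (fun n => { d n with map_smul' := fun b p => by simp [smul_eq] })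
      { toFun := fun p => topEquiv φ (ε p)
        map_add' := by simp
        map_smul' := fun b p => by rw [smul_eq, map_smul, topEquiv_smul]; rfl } :=
  let idEquiv (n : ℕ) : P n ≃ₛₗ[(φ.toRingEquiv.op : Aᵐᵒᵖ →+* Bᵐᵒᵖ)] P n :=
    { AddEquiv.refl (P n) with map_smul' := fun b p => by simp [smul_eq] }
  { projective := fun n =>
      have := h.projective n
      Module.Projective.of_equiv (idEquiv n)
    graded := fun n =>
      { isInternal := (h.graded n).isInternal
        smul_mem := by
          rintro k l p _ hp ⟨a, ha, rfl⟩
          rw [smul_eq]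
          simpa using (h.graded n).smul_mem k l p a hp ha }
    d_mem := h.d_mem
    ε_mem := fun k p hp => by
      obtain ⟨a, ha, hp⟩ := h.ε_mem k p hp
      exact ⟨φ a, ⟨a, ha, rfl⟩, congrArg (topEquiv φ) hp⟩
    exact := h.exact
    exact_zero := fun p =>
      (map_eq_zero_iff _ (topEquiv φ).injective).trans (h.exact_zero p)
    surjective := (topEquiv φ).surjective.comp h.surjective
    generated := fun n => by
      have span_image := congrArg (Submodule.map (idEquiv n).toLinearMap) (h.generated n)
      rwa [Submodule.map_span, Submodule.map_top, (idEquiv n).range,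
        show ⇑(idEquiv n).toLinearMap = id from rfl, Set.image_id] at span_image }

end Resolution

theorem IsKoszulAlgebra.map (h : IsKoszulAlgebra 𝒜) : IsKoszulAlgebra (mapGrading 𝒜 φ) := by
  obtain ⟨_, ⟨_, _⟩, P, _, _, 𝓟, d, ε, hP⟩ := h
  let (n : ℕ) : Module Bᵐᵒᵖ (P n) := Module.compHom (P n) (φ.toRingEquiv.symm.op : Bᵐᵒᵖ →+* Aᵐᵒᵖ)
  exact ⟨Module.Finite.equiv φ.toLinearEquiv, ⟨inferInstance, inferInstance⟩,
    P, _, _, 𝓟, _, _, hP.map φ fun _ _ _ => rfl⟩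

end KoszulTransport

section Radical

theorem mem_jacobson_op_iff_of_nil_ker {A R : Type*} [Ring A] [Ring R] [IsSemisimpleRing R]
    (π : A →+* R) (surj : Function.Surjective π) (nil : ∀ y, π y = 0 → IsNilpotent y) {y : A} :
    y ∈ Module.jacobson Aᵐᵒᵖ A ↔ π y = 0 := by
  constructor <;> intro hy
  · have : RingHomSurjective π.op := ⟨op_surjective.comp (surj.comp unop_surjective)⟩
    let f : A →ₛₗ[π.op] R :=
      { toFun := π, map_add' := map_add π, map_smul' := fun a b => map_mul π b a.unop }
    have : IsSemisimpleModule Rᵐᵒᵖ R := .congr (unopRightLinearEquiv R).symm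
    have := Module.le_comap_jacobson f hy
    rwa [IsSemisimpleModule.jacobson_eq_bot Rᵐᵒᵖ R] at this
  · refine Submodule.mem_sInf.2 fun m hm => by_contra fun hym => hm.1 ?_
    have htop : m ⊔ Submodule.span Aᵐᵒᵖ {y} = ⊤ :=
      hm.2 _ <| left_lt_sup.2 fun h => hym <| h <| Submodule.mem_span_singleton_self y
    obtain ⟨a, ha, b, hb, hab⟩ := Submodule.mem_sup.1 (htop ▸ Submodule.mem_top (x := (1 : A)))
    obtain ⟨c, rfl⟩ := Submodule.mem_span_singleton.1 hb
    have hc : π (c • y) = 0 := by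
      rw [← op_unop c, op_smul_eq_mul, map_mul, hy, zero_mul]
    obtain ⟨u, hu⟩ : IsUnit a := eq_sub_of_add_eq hab ▸ (nil _ hc).isUnit_one_sub
    refine (Submodule.eq_top_iff').2 fun z => ?_
    simpa [← hu] using m.smul_mem (op (↑u⁻¹ * z)) ha

end Radical

theorem zmod_two_eq_or_eq_add_one (m l : ZMod 2) : m = l ∨ m = l + 1 := by
  revert m l
  decide

namespace PathAlgebra

variable {K : Type u} [Field K] {V : Type v} [Quiver.{w} V] {R : Type*} [Ring R] [Algebra K R]

/-- The value `e a₀ * (r f₁ * e a₁) * ⋯ * (r fₙ * e aₙ)` of a path with vertices `a₀, …, aₙ` and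
arrows `f₁, …, fₙ`, for given ring elements `e a` and `r f`. -/
def pathValue (e : V → R) (r : ∀ {a b : V}, (a ⟶ b) → R) {a : V} :
    ∀ {b : V}, Quiver.Path a b → R
  | _, .nil => e a
  | b, .cons p f => pathValue e r p * (r f * e b)

variable (K) in
/-- The linear extension of `pathValue` to the path algebra. -/
def liftLinear (e : V → R) (r : ∀ {a b : V}, (a ⟶ b) → R) : PathAlgebra K V →ₗ[K] R :=
  (pathBasis K V).constr K fun p => pathValue e r p.2.2

theorem liftLinear_ofPath (e : V → R) (r : ∀ {a b : V}, (a ⟶ b) → R) {a b : V}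
    (p : Quiver.Path a b) : liftLinear K e r (ofPath K p) = pathValue e r p :=
  (pathBasis K V).constr_basis K _ _

theorem pathValue_mem_graded {𝒜 : ℕ → Submodule K R} [SetLike.GradedMonoid 𝒜] {e : V → R}
    {r : ∀ {a b : V}, (a ⟶ b) → R} (he : ∀ a, e a ∈ 𝒜 0)
    (hr : ∀ {a b : V} (f : a ⟶ b), r f ∈ 𝒜 1) {a b : V} (p : Quiver.Path a b) :
    pathValue e r p ∈ 𝒜 p.length := by
  induction p with
  | nil => exact he a
  | cons p f ih => exact SetLike.mul_mem_graded ih (SetLike.mul_mem_graded (hr f) (he _))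

variable (K V) in
theorem iSup_lengthComponent : ⨆ n, lengthComponent K V n = ⊤ := by
  refine eq_top_iff.2 fun y _ => ?_
  induction y using induction_on with
  | h0 => exact zero_mem _
  | hadd y z hy hz => exact add_mem (hy trivial) (hz trivial)
  | hpath c p =>
    exact Submodule.smul_mem _ _
      (Submodule.mem_iSup_of_mem p.length (Submodule.subset_span ⟨_, _, p, rfl, rfl⟩))

variable [Fintype V] {e : V → R} (he : CompleteOrthogonalIdempotents e)
  (r : ∀ {a b : V}, (a ⟶ b) → R)
include he

theorem pathValue_mul_pathValue {a b c : V} (p : Quiver.Path a b) (q : Quiver.Path b c) :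
    pathValue e r p * pathValue e r q = pathValue e r (p.comp q) := by
  induction q with
  | nil => cases p <;> simp only [pathValue, Quiver.Path.comp_nil, mul_assoc, (he.idem _).eq]
  | cons q f ih => rw [pathValue, ← mul_assoc, ih, Quiver.Path.comp_cons, pathValue]

theorem pathValue_mul_pathValue_of_ne {a b c d : V} (p : Quiver.Path a b) (q : Quiver.Path c d)
    (h : b ≠ c) : pathValue e r p * pathValue e r q = 0 := by
  induction q with
  | nil => cases p <;> simp only [pathValue, mul_assoc, he.ortho h, mul_zero]
  | cons q f ih => rw [pathValue, ← mul_assoc, ih, zero_mul]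

variable [DecidableEq V]

theorem liftLinear_mul (y z : PathAlgebra K V) :
    liftLinear K e r (y * z) = liftLinear K e r y * liftLinear K e r z := by
  induction y using induction_on with
  | h0 => simp only [zero_mul, map_zero]
  | hadd y₁ y₂ h₁ h₂ => simp only [add_mul, map_add, h₁, h₂]
  | @hpath c a b p =>
  induction z using induction_on with
  | h0 => simp only [mul_zero, map_zero]
  | hadd z₁ z₂ h₁ h₂ => simp only [mul_add, map_add, h₁, h₂]
  | @hpath c' a' b' p' =>
  simp only [smul_mul_assoc, mul_smul_comm, map_smul, liftLinear_ofPath]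
  rcases eq_or_ne b a' with rfl | h
  · rw [ofPath_mul_ofPath_same, liftLinear_ofPath, pathValue_mul_pathValue he]
  · rw [ofPath_mul_ofPath_ne K _ _ h, map_zero, pathValue_mul_pathValue_of_ne he _ _ _ h]

/-- The homomorphism from the path algebra to an algebra `R` that is given by complete orthogonal
idempotents `e a` of `R` for the vertices and arbitrary elements `r f` of `R` for the arrows: it
sends an arrow `f : a ⟶ b` to `e a * r f * e b`. -/
def lift : PathAlgebra K V →ₐ[K] R :=
  AlgHom.ofLinearMap (liftLinear K e r)
    (by simp only [one_def, map_sum, vertex, liftLinear_ofPath, pathValue, he.complete])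
    (liftLinear_mul he r)

theorem lift_ofPath {a b : V} (p : Quiver.Path a b) :
    lift (K := K) he r (ofPath K p) = pathValue e r p :=
  liftLinear_ofPath e r p

theorem lift_vertex (a : V) : lift (K := K) he r (vertex K a) = e a :=
  liftLinear_ofPath e r _

theorem lift_arrow {a b : V} (f : a ⟶ b) :
    lift (K := K) he r (arrow K f) = e a * (r f * e b) :=
  liftLinear_ofPath e r _

omit he

theorem algHom_ext {φ ψ : PathAlgebra K V →ₐ[K] R}
    (vertex : ∀ a, φ (vertex K a) = ψ (vertex K a))
    (arrow : ∀ {a b : V} (f : a ⟶ b), φ (arrow K f) = ψ (arrow K f)) : φ = ψ := by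
  refine AlgHom.toLinearMap_injective ((pathBasis K V).ext fun ⟨a, b, p⟩ => ?_)
  change φ (ofPath K p) = ψ (ofPath K p)
  induction p with
  | nil => exact vertex a
  | cons p f ih =>
    rw [show p.cons f = p.comp f.toPath from rfl, ← ofPath_mul_ofPath_same, map_mul, map_mul, ih]
    exact congrArg _ (arrow f)

variable (K V) in
theorem completeOrthogonalIdempotents_vertex :
    CompleteOrthogonalIdempotents (vertex K : V → PathAlgebra K V) where
  idem a := by simp only [IsIdempotentElem, vertex, ofPath_mul_ofPath_same, Quiver.Path.comp_nil]
  ortho a b h := ofPath_mul_ofPath_ne K _ _ h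
  complete := (one_def K).symm

end PathAlgebra

/-- The algebra `R ⊕ ⨁ₗ R xₗ ⊕ R s` generated over the commutative ring `R` by elements `xₗ` and `s`
with `xₗ g = σ(g) xₗ` for `g ∈ R`, `xₗ xₘ = 0` for `l ≠ m`, `xₗ ² = tₗ s` and `xₗ s = s xₗ = 0`. -/
@[ext]
structure SkewQuadric {K : Type u} [Field K] {R : Type u} [CommRing R] [Algebra K R] {ι : Type}
    (σ : R ≃ₐ[K] R) (t : ι → Rˣ) : Type u where
  const : R
  lin : ι → R
  quad : R

namespace SkewQuadric

variable {K : Type u} [Field K] {R : Type u} [CommRing R] [Algebra K R] {ι : Type}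
  {σ : R ≃ₐ[K] R} {t : ι → Rˣ}

section Ring

/-- The underlying additive group of `SkewQuadric σ t` is `R × (ι → R) × R`. -/
def equivProd (σ : R ≃ₐ[K] R) (t : ι → Rˣ) : SkewQuadric σ t ≃ R × (ι → R) × R where
  toFun y := (y.const, y.lin, y.quad)
  invFun y := ⟨y.1, y.2.1, y.2.2⟩

instance : AddCommGroup (SkewQuadric σ t) := (equivProd σ t).addCommGroup

instance : Module K (SkewQuadric σ t) := (equivProd σ t).module K

@[simp] theorem const_zero : (0 : SkewQuadric σ t).const = 0 := rfl
@[simp] theorem lin_zero : (0 : SkewQuadric σ t).lin = 0 := rfl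
@[simp] theorem quad_zero : (0 : SkewQuadric σ t).quad = 0 := rfl

@[simp] theorem const_add (y z : SkewQuadric σ t) : (y + z).const = y.const + z.const := rfl
@[simp] theorem lin_add (y z : SkewQuadric σ t) : (y + z).lin = y.lin + z.lin := rfl
@[simp] theorem quad_add (y z : SkewQuadric σ t) : (y + z).quad = y.quad + z.quad := rfl

@[simp] theorem const_smul (c : K) (y : SkewQuadric σ t) : (c • y).const = c • y.const := rfl
@[simp] theorem lin_smul (c : K) (y : SkewQuadric σ t) : (c • y).lin = c • y.lin := rfl
@[simp] theorem quad_smul (c : K) (y : SkewQuadric σ t) : (c • y).quad = c • y.quad := rfl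

/-- The components of an element, as a linear equivalence. -/
def linearEquivProd (σ : R ≃ₐ[K] R) (t : ι → Rˣ) :
    SkewQuadric σ t ≃ₗ[K] R × (ι → R) × R where
  __ := equivProd σ t
  map_add' _ _ := rfl
  map_smul' _ _ := rfl

instance [FiniteDimensional K R] [Finite ι] : FiniteDimensional K (SkewQuadric σ t) :=
  (linearEquivProd σ t).symm.finiteDimensional

instance : One (SkewQuadric σ t) := ⟨⟨1, 0, 0⟩⟩

@[simp] theorem const_one : (1 : SkewQuadric σ t).const = 1 := rfl
@[simp] theorem lin_one : (1 : SkewQuadric σ t).lin = 0 := rfl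
@[simp] theorem quad_one : (1 : SkewQuadric σ t).quad = 0 := rfl

variable [Fintype ι]

instance : Mul (SkewQuadric σ t) where
  mul y z :=
    ⟨y.const * z.const, fun l => y.const * z.lin l + y.lin l * σ z.const,
      y.const * z.quad + ∑ l, t l * (y.lin l * σ (z.lin l)) + y.quad * σ (σ z.const)⟩

@[simp] theorem const_mul (y z : SkewQuadric σ t) : (y * z).const = y.const * z.const := rfl

@[simp] theorem lin_mul (y z : SkewQuadric σ t) (l : ι) :
    (y * z).lin l = y.const * z.lin l + y.lin l * σ z.const := rfl

@[simp] theorem quad_mul (y z : SkewQuadric σ t) :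
    (y * z).quad =
      y.const * z.quad + ∑ l, t l * (y.lin l * σ (z.lin l)) + y.quad * σ (σ z.const) := rfl

instance : Ring (SkewQuadric σ t) where
  __ := (inferInstance : AddCommGroup (SkewQuadric σ t))
  one_mul y := by ext <;> simp
  mul_one y := by ext <;> simp
  zero_mul y := by ext <;> simp
  mul_zero y := by ext <;> simp
  left_distrib x y z := by
    ext <;> simp only [const_mul, lin_mul, quad_mul, const_add, lin_add, quad_add, Pi.add_apply,
      map_add, mul_add, Finset.sum_add_distrib] <;> ring
  right_distrib x y z := by
    ext <;> simp only [const_mul, lin_mul, quad_mul, const_add, lin_add, quad_add, Pi.add_apply,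
      add_mul, mul_add, Finset.sum_add_distrib] <;> ring
  mul_assoc x y z := by
    ext
    · exact mul_assoc _ _ _
    · simp only [const_mul, lin_mul, map_mul]
      ring
    · have hsum : ∑ l, t l * ((x * y).lin l * σ (z.lin l)) +
          (∑ l, t l * (x.lin l * σ (y.lin l))) * σ (σ z.const) =
          x.const * ∑ l, t l * (y.lin l * σ (z.lin l)) +
          ∑ l, t l * (x.lin l * σ ((y * z).lin l)) := by
        simp only [Finset.mul_sum, Finset.sum_mul, ← Finset.sum_add_distrib, lin_mul, map_add,
          map_mul]
        exact Finset.sum_congr rfl fun l _ => by ring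
      simp only [quad_mul, const_mul, map_mul]
      linear_combination hsum

instance : Algebra K (SkewQuadric σ t) :=
  Algebra.ofModule
    (fun c y z => by ext <;> simp [Finset.smul_sum])
    (fun c y z => by ext <;> simp [Finset.smul_sum])

/-- The subalgebra `R` of `SkewQuadric σ t`. -/
def ofConst : R →ₐ[K] SkewQuadric σ t :=
  AlgHom.ofLinearMap
    { toFun g := ⟨g, 0, 0⟩
      map_add' _ _ := by ext <;> simp
      map_smul' _ _ := by ext <;> simp }
    rfl (fun _ _ => by ext <;> simp)

theorem ofConst_mul (g : R) (y : SkewQuadric σ t) :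
    ofConst g * y = ⟨g * y.const, fun l => g * y.lin l, g * y.quad⟩ := by
  ext <;> simp [ofConst]

/-- The augmentation that sends every `xₗ` to `0`. -/
def constHom (σ : R ≃ₐ[K] R) (t : ι → Rˣ) : SkewQuadric σ t →ₐ[K] R :=
  AlgHom.ofLinearMap { toFun := const, map_add' := const_add, map_smul' := const_smul }
    rfl const_mul

end Ring

section Grading

/-- The grading of `SkewQuadric σ t` in which `R`, `xₗ` and `s` have the degrees `0`, `1`, `2`. -/
def grading (σ : R ≃ₐ[K] R) (t : ι → Rˣ) (n : ℕ) : Submodule K (SkewQuadric σ t) where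
  carrier := {y | (n ≠ 0 → y.const = 0) ∧ (n ≠ 1 → y.lin = 0) ∧ (n ≠ 2 → y.quad = 0)}
  zero_mem' := by simp
  add_mem' := fun {y z} hy hz => by
    refine ⟨fun h => ?_, fun h => ?_, fun h => ?_⟩
    · rw [const_add, hy.1 h, hz.1 h, add_zero]
    · rw [lin_add, hy.2.1 h, hz.2.1 h, add_zero]
    · rw [quad_add, hy.2.2 h, hz.2.2 h, add_zero]
  smul_mem' := fun c y hy => by
    refine ⟨fun h => ?_, fun h => ?_, fun h => ?_⟩
    · rw [const_smul, hy.1 h, smul_zero]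
    · rw [lin_smul, hy.2.1 h, smul_zero]
    · rw [quad_smul, hy.2.2 h, smul_zero]

theorem mem_grading {n : ℕ} {y : SkewQuadric σ t} :
    y ∈ grading σ t n ↔
      (n ≠ 0 → y.const = 0) ∧ (n ≠ 1 → y.lin = 0) ∧ (n ≠ 2 → y.quad = 0) := Iff.rfl

/-- The projection of `SkewQuadric σ t` to its homogeneous component of degree `n`. -/
def gradingProj (σ : R ≃ₐ[K] R) (t : ι → Rˣ) (n : ℕ) : SkewQuadric σ t →+ SkewQuadric σ t where
  toFun y :=
    ⟨if n = 0 then y.const else 0, if n = 1 then y.lin else 0, if n = 2 then y.quad else 0⟩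
  map_zero' := by ext <;> simp
  map_add' y z := by ext <;> simp [ite_add_zero]

theorem gradingProj_apply (n : ℕ) (y : SkewQuadric σ t) :
    gradingProj σ t n y =
      ⟨if n = 0 then y.const else 0, if n = 1 then y.lin else 0, if n = 2 then y.quad else 0⟩ :=
  rfl

theorem isInternal_grading : DirectSum.IsInternal (grading σ t) := by
  refine isInternal_of_projections _ (gradingProj σ t) (fun n y => ?_) (fun n y hy => ?_)
    (fun n m h y hy => ?_) (fun y => ⟨Finset.range 3, ?_⟩)
  · simp +contextual [mem_grading, gradingProj_apply]
  · rw [mem_grading] at hy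
    ext : 1 <;> simp only [gradingProj_apply, ite_eq_left_iff] <;> grind
  · rw [mem_grading] at hy
    ext : 1 <;> simp only [gradingProj_apply] <;>
      grind [const_zero, lin_zero, quad_zero]
  · ext <;> simp [Finset.sum_range_succ, gradingProj_apply]

variable [Fintype ι]

instance gradedMonoid_grading : SetLike.GradedMonoid (grading σ t) where
  one_mem := by simp [mem_grading]
  mul_mem n m y z hy hz := by
    obtain ⟨hyc, hyl, hyq⟩ := mem_grading.1 hy
    obtain ⟨hzc, hzl, hzq⟩ := mem_grading.1 hz
    refine mem_grading.2 ⟨fun h => ?_, fun h => funext fun l => ?_, fun h => ?_⟩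
    · rw [const_mul]
      grind
    · have h₁ : y.const * z.lin l = 0 := by
        by_cases hn : n = 0
        · rw [hzl (by lia), Pi.zero_apply, mul_zero]
        · rw [hyc hn, zero_mul]
      have h₂ : y.lin l * σ z.const = 0 := by
        by_cases hn : n = 1
        · rw [hzc (by lia), map_zero, mul_zero]
        · rw [hyl hn, Pi.zero_apply, zero_mul]
      rw [lin_mul, h₁, h₂, add_zero, Pi.zero_apply]
    · have h₁ : y.const * z.quad = 0 := by grind
      have h₂ (l : ι) : y.lin l * σ (z.lin l) = 0 := by
        by_cases hn : n = 1
        · rw [hzl (by lia), Pi.zero_apply, map_zero, mul_zero]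
        · rw [hyl hn, Pi.zero_apply, zero_mul]
      have h₃ : y.quad * σ (σ z.const) = 0 := by grind
      simp only [quad_mul, h₁, h₂, h₃, mul_zero, Finset.sum_const_zero, add_zero]

instance gradedAlgebra_grading : GradedAlgebra (grading σ t) :=
  { gradedMonoid_grading, isInternal_grading.chooseDecomposition with }

instance [IsSemisimpleRing R] : IsSemisimpleRing (grading σ t 0) :=
  RingEquiv.isSemisimpleRing (R := R)
    { toFun g := ⟨ofConst g, by simp [mem_grading, ofConst]⟩
      invFun y := y.1.const
      map_add' _ _ := Subtype.ext (map_add ofConst _ _)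
      map_mul' _ _ := Subtype.ext (map_mul ofConst _ _)
      left_inv _ := rfl
      right_inv y := Subtype.ext <|
        SkewQuadric.ext rfl (y.2.2.1 zero_ne_one).symm (y.2.2.2 two_ne_zero.symm).symm }

theorem mem_jacobson_iff [IsSemisimpleRing R] {y : SkewQuadric σ t} :
    y ∈ Module.jacobson (SkewQuadric σ t)ᵐᵒᵖ (SkewQuadric σ t) ↔ y.const = 0 :=
  mem_jacobson_op_iff_of_nil_ker (constHom σ t : SkewQuadric σ t →+* R) (fun g => ⟨ofConst g, rfl⟩)
    fun y (hy : y.const = 0) => ⟨3, by ext <;> simp [pow_succ, hy]⟩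

end Grading

section Monomial

variable [DecidableEq ι]

/-- The element `g xₗ` of `SkewQuadric σ t`, for `g ∈ R`. -/
def monomial (σ : R ≃ₐ[K] R) (t : ι → Rˣ) (l : ι) (g : R) : SkewQuadric σ t := ⟨0, Pi.single l g, 0⟩

@[simp] theorem const_monomial (l : ι) (g : R) : (monomial σ t l g).const = 0 := rfl

@[simp] theorem lin_monomial (l : ι) (g : R) : (monomial σ t l g).lin = Pi.single l g := rfl

@[simp] theorem quad_monomial (l : ι) (g : R) : (monomial σ t l g).quad = 0 := rfl

theorem monomial_mem_grading (l : ι) (g : R) : monomial σ t l g ∈ grading σ t 1 := by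
  simp [mem_grading]

variable [Fintype ι]

@[simp] theorem quad_monomial_mul (l : ι) (g : R) (y : SkewQuadric σ t) :
    (monomial σ t l g * y).quad = t l * (g * σ (y.lin l)) := by
  simp only [quad_mul, const_monomial, lin_monomial, quad_monomial, zero_mul, zero_add, add_zero]
  rw [Fintype.sum_eq_single l fun m h => by simp [Pi.single_eq_of_ne h], Pi.single_eq_same]

@[simp] theorem quad_mul_monomial (l : ι) (g : R) (y : SkewQuadric σ t) :
    (y * monomial σ t l g).quad = t l * (y.lin l * σ g) := by
  simp only [quad_mul, const_monomial, lin_monomial, quad_monomial, mul_zero, map_zero, zero_add,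
    add_zero]
  rw [Fintype.sum_eq_single l fun m h => by simp [Pi.single_eq_of_ne h], Pi.single_eq_same]

theorem monomial_mul_monomial_self (l : ι) (f g : R) :
    monomial σ t l f * monomial σ t l g = ⟨0, 0, t l * (f * σ g)⟩ := by
  ext
  · simp
  · simp
  · rw [quad_monomial_mul, lin_monomial, Pi.single_eq_same]

theorem monomial_mul_monomial_of_ne {l m : ι} (h : l ≠ m) (f g : R) :
    monomial σ t l f * monomial σ t m g = 0 := by
  ext
  · simp
  · simp
  · rw [quad_monomial_mul, lin_monomial, Pi.single_eq_of_ne h, map_zero, mul_zero, mul_zero,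
      quad_zero]

theorem monomial_one_mul_ofConst (l : ι) (g : R) :
    monomial σ t l 1 * ofConst g = ofConst (σ g) * monomial σ t l 1 := by
  ext i <;> simp [ofConst, Pi.single_apply]

omit [DecidableEq ι] in
theorem isSelfInjectiveAlgebra [FiniteDimensional K R] (τ : R →ₗ[K] K)
    (hτ : ∀ c, (∀ b, τ (b * c) = 0) → c = 0) : IsSelfInjectiveAlgebra K (SkewQuadric σ t) := by
  classical
  let quadLin : SkewQuadric σ t →ₗ[K] R := ⟨⟨quad, quad_add⟩, quad_smul⟩
  have map_eq_zero {g : R} (h : σ g = 0) : g = 0 := (map_eq_zero_iff σ σ.injective).1 h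
  refine isSelfInjectiveAlgebra_of_frobeniusForm (τ ∘ₗ quadLin) (fun y hy => ?_) fun y hy => ?_
  · replace hy b : τ (b * y).quad = 0 := hy b
    ext l
    · refine map_eq_zero (map_eq_zero (hτ _ fun b => ?_))
      simpa using hy ⟨0, 0, b⟩
    · refine map_eq_zero ((t l).mul_right_eq_zero.1 (hτ _ fun b => ?_))
      simpa only [quad_monomial_mul, mul_left_comm b] using hy (monomial σ t l b)
    · refine hτ _ fun b => ?_
      simpa using hy ⟨b, 0, 0⟩
  · replace hy b : τ (y * b).quad = 0 := hy b
    ext l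
    · refine hτ _ fun b => ?_
      simpa [mul_comm b] using hy ⟨0, 0, b⟩
    · refine (t l).mul_right_eq_zero.1 (hτ _ fun b => ?_)
      simpa only [quad_mul_monomial, AlgEquiv.apply_symm_apply, mul_assoc, mul_comm b] using
        hy (monomial σ t l (σ.symm b))
    · refine hτ _ fun b => ?_
      simpa [mul_comm b] using hy ⟨σ.symm (σ.symm b), 0, 0⟩

end Monomial

section Lift

variable {B : Type*} [Ring B] [Algebra K B]

/-- A homomorphism `ρ` and elements `xₗ`, `s` that satisfy the relations that present
`SkewQuadric σ t`. -/
structure IsSystem (σ : R ≃ₐ[K] R) (t : ι → Rˣ) (ρ : R →ₐ[K] B) (x : ι → B) (s : B) : Prop where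
  comm : ∀ l g, x l * ρ g = ρ (σ g) * x l
  ortho : ∀ l m, l ≠ m → x l * x m = 0
  sq : ∀ l, x l * x l = ρ (t l) * s

namespace IsSystem

variable {ρ : R →ₐ[K] B} {x : ι → B} {s : B} (h : IsSystem σ t ρ x s)
include h

theorem eq_inv_mul_sq (l : ι) : s = ρ ↑(t l)⁻¹ * (x l * x l) := by
  rw [h.sq, ← mul_assoc, ← map_mul, Units.inv_mul, map_one, one_mul]

theorem quad_comm [Nonempty ι] (g : R) : s * ρ g = ρ (σ (σ g)) * s := by
  let l := Classical.arbitrary ι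
  rw [h.eq_inv_mul_sq l, mul_assoc, mul_assoc, h.comm, ← mul_assoc (x l), h.comm, ← mul_assoc,
    ← mul_assoc, ← map_mul, mul_comm, map_mul, mul_assoc, mul_assoc]

theorem quad_mul_lin [Nontrivial ι] (l : ι) : s * x l = 0 := by
  obtain ⟨m, hm⟩ := exists_ne l
  rw [h.eq_inv_mul_sq m, mul_assoc, mul_assoc, h.ortho m l hm, mul_zero, mul_zero]

theorem lin_mul_quad [Nontrivial ι] (l : ι) : x l * s = 0 := by
  obtain ⟨m, hm⟩ := exists_ne l
  rw [h.eq_inv_mul_sq m, ← mul_assoc, h.comm, mul_assoc, ← mul_assoc (x l), h.ortho l m hm.symm,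
    zero_mul, mul_zero]

theorem quad_mul_quad [Nontrivial ι] : s * s = 0 := by
  obtain ⟨l⟩ : Nonempty ι := inferInstance
  nth_rw 2 [h.eq_inv_mul_sq l]
  rw [← mul_assoc, h.quad_comm, mul_assoc, ← mul_assoc s, h.quad_mul_lin, zero_mul, mul_zero]

variable [Fintype ι]

theorem sum_mul_sum (b b' : ι → R) :
    (∑ l, ρ (b l) * x l) * ∑ l, ρ (b' l) * x l = ρ (∑ l, t l * (b l * σ (b' l))) * s := by
  simp only [Finset.sum_mul, map_sum]
  refine Finset.sum_congr rfl fun l _ => ?_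
  rw [Finset.mul_sum, Finset.sum_eq_single l]
  · rw [mul_assoc, ← mul_assoc (x l), h.comm, mul_assoc, h.sq, ← mul_assoc, ← mul_assoc, ← map_mul,
      ← map_mul, mul_comm _ (t l : R)]
  · intro m _ hm
    rw [mul_assoc, ← mul_assoc (x l), h.comm, mul_assoc, h.ortho l m hm.symm, mul_zero, mul_zero]
  · simp

/-- The homomorphism from `SkewQuadric σ t` to an algebra that is given by the images of `R`, the
`xₗ` and `s`. -/
def lift [Nontrivial ι] : SkewQuadric σ t →ₐ[K] B :=
  AlgHom.ofLinearMap
    { toFun y := ρ y.const + ∑ l, ρ (y.lin l) * x l + ρ y.quad * s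
      map_add' y z := by
        simp only [const_add, lin_add, quad_add, Pi.add_apply, map_add, add_mul,
          Finset.sum_add_distrib]
        abel
      map_smul' c y := by simp [Finset.smul_sum] }
    (by simp)
    (fun y z => by
      have lin_const : (∑ l, ρ (y.lin l) * x l) * ρ z.const =
          ∑ l, ρ (y.lin l * σ z.const) * x l := by
        simp only [Finset.sum_mul, mul_assoc, h.comm, map_mul]
      have lin_quad : (∑ l, ρ (y.lin l) * x l) * (ρ z.quad * s) = 0 := by
        simp only [Finset.sum_mul, mul_assoc, ← mul_assoc (x _), h.comm]
        simp only [h.lin_mul_quad, mul_zero, Finset.sum_const_zero]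
      have quad_lin : ρ y.quad * s * ∑ l, ρ (z.lin l) * x l = 0 := by
        simp only [Finset.mul_sum, mul_assoc, ← mul_assoc s, h.quad_comm]
        simp only [h.quad_mul_lin, mul_zero, Finset.sum_const_zero]
      have quad_quad : ρ y.quad * s * (ρ z.quad * s) = 0 := by
        rw [mul_assoc, ← mul_assoc s, h.quad_comm, mul_assoc, h.quad_mul_quad, mul_zero, mul_zero]
      have quad_const : ρ y.quad * s * ρ z.const = ρ (y.quad * σ (σ z.const)) * s := by
        rw [mul_assoc, h.quad_comm, ← mul_assoc, ← map_mul]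
      simp only [LinearMap.coe_mk, AddHom.coe_mk, add_mul, mul_add, h.sum_mul_sum, lin_const,
        lin_quad, quad_lin, quad_quad, quad_const]
      simp only [const_mul, lin_mul, quad_mul, map_add, map_mul, add_mul, Finset.mul_sum,
        mul_assoc, Finset.sum_add_distrib]
      abel)

theorem lift_apply [Nontrivial ι] (y : SkewQuadric σ t) :
    h.lift y = ρ y.const + ∑ l, ρ (y.lin l) * x l + ρ y.quad * s := rfl

theorem lift_ofConst [Nontrivial ι] (g : R) : h.lift (ofConst g) = ρ g := by
  simp [lift_apply, ofConst]

theorem lift_monomial [Nontrivial ι] [DecidableEq ι] (l : ι) (g : R) :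
    h.lift (monomial σ t l g) = ρ g * x l := by
  simp [lift_apply, Pi.single_apply, apply_ite]

end IsSystem

theorem algHom_ext [Fintype ι] [DecidableEq ι] [Nonempty ι] {φ ψ : SkewQuadric σ t →ₐ[K] B}
    (const : ∀ g, φ (ofConst g) = ψ (ofConst g))
    (lin : ∀ l, φ (monomial σ t l 1) = ψ (monomial σ t l 1)) : φ = ψ := by
  let m := Classical.arbitrary ι
  refine AlgHom.toLinearMap_injective <|
    ((linearEquivProd σ t).symm.eq_comp_toLinearMap_iff _ _).1 ?_
  refine LinearMap.prod_ext (LinearMap.ext const)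
    (LinearMap.prod_ext (LinearMap.pi_ext fun l g => ?_) (LinearMap.ext fun g => ?_))
  · have hg : monomial σ t l g = ofConst g * monomial σ t l 1 := by
      ext i <;> simp [ofConst, Pi.single_apply]
    change φ (monomial σ t l g) = ψ (monomial σ t l g)
    rw [hg, map_mul, map_mul, const, lin]
  · have hg : (⟨0, 0, g⟩ : SkewQuadric σ t) =
        ofConst (g * ↑(t m)⁻¹) * (monomial σ t m 1 * monomial σ t m 1) := by
      rw [monomial_mul_monomial_self, ofConst_mul]
      ext <;> simp
    change φ ⟨0, 0, g⟩ = ψ ⟨0, 0, g⟩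
    rw [hg, map_mul φ, map_mul φ, map_mul ψ, map_mul ψ, const, lin]

end Lift

section Resolution

variable {t : ZMod 2 → Rˣ} {n : ℕ} {l : ZMod 2} {α : Rˣ}

/-- The homomorphism `(pⱼ) ↦ (xₗ pⱼ + α xₗ₊₁ pⱼ₊₁)` of free right modules. -/
def differential (σ : R ≃ₐ[K] R) (t : ZMod 2 → Rˣ) (n : ℕ) (l : ZMod 2) (α : Rˣ) :
    (Fin (n + 1) → SkewQuadric σ t) →ₗ[(SkewQuadric σ t)ᵐᵒᵖ] (Fin n → SkewQuadric σ t) where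
  toFun p j := monomial σ t l 1 * p j.castSucc + monomial σ t (l + 1) α * p j.succ
  map_add' p p' := by
    ext1 j
    simp only [Pi.add_apply, mul_add, add_add_add_comm]
  map_smul' c p := by
    ext1 j
    simp only [Pi.smul_apply, RingHom.id_apply, mul_smul_comm, smul_add]

theorem differential_apply (p : Fin (n + 1) → SkewQuadric σ t) (j : Fin n) :
    differential σ t n l α p j =
      monomial σ t l 1 * p j.castSucc + monomial σ t (l + 1) α * p j.succ := rfl

section Components

variable (p : Fin (n + 1) → SkewQuadric σ t) (j : Fin n)

theorem const_differential : (differential σ t n l α p j).const = 0 := by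
  simp [differential_apply]

theorem lin_differential : (differential σ t n l α p j).lin l = σ (p j.castSucc).const := by
  simp [differential_apply]

theorem lin_add_one_differential :
    (differential σ t n l α p j).lin (l + 1) = α * σ (p j.succ).const := by
  simp [differential_apply]

theorem quad_differential :
    (differential σ t n l α p j).quad =
      t l * σ ((p j.castSucc).lin l) + t (l + 1) * (α * σ ((p j.succ).lin (l + 1))) := by
  rw [differential_apply, quad_add, quad_monomial_mul, quad_monomial_mul, one_mul]

end Components

theorem differential_eq_zero_iff (p : Fin (n + 2) → SkewQuadric σ t) :
    differential σ t (n + 1) l α p = 0 ↔ (∀ j, (p j).const = 0) ∧ ∀ j : Fin (n + 1),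
      t l * σ ((p j.castSucc).lin l) + t (l + 1) * (α * σ ((p j.succ).lin (l + 1))) = 0 := by
  constructor
  · intro h
    refine ⟨fun j => ?_, fun j => by rw [← quad_differential, h]; rfl⟩
    refine (map_eq_zero_iff σ σ.injective).1 ?_
    cases j using Fin.lastCases with
    | last =>
      refine α.mul_right_eq_zero.1 ?_
      rw [← Fin.succ_last, ← lin_add_one_differential, h]
      rfl
    | cast j =>
      rw [← lin_differential, h]
      rfl
  · rintro ⟨hc, hq⟩
    ext j m
    · exact const_differential p j
    · obtain rfl | rfl := zmod_two_eq_or_eq_add_one m l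
      · rw [lin_differential, hc, map_zero]
        rfl
      · rw [lin_add_one_differential, hc, map_zero, mul_zero]
        rfl
    · rw [quad_differential, hq]
      rfl

theorem mem_range_differential_iff (p : Fin (n + 1) → SkewQuadric σ t) :
    p ∈ Set.range (differential σ t (n + 1) l α) ↔ (∀ j, (p j).const = 0) ∧
      ∀ j : Fin n, (p j.castSucc).lin (l + 1) = α * (p j.succ).lin l := by
  constructor
  · rintro ⟨w, rfl⟩
    refine ⟨const_differential w, fun j => ?_⟩
    rw [lin_add_one_differential, lin_differential, Fin.succ_castSucc]
  · rintro ⟨hc, hl⟩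
    let w : Fin (n + 2) → SkewQuadric σ t :=
      Fin.cons ⟨σ.symm ((p 0).lin l), 0, 0⟩ fun j =>
        ⟨σ.symm (↑α⁻¹ * (p j).lin (l + 1)),
          Pi.single (l + 1) (σ.symm (↑α⁻¹ * (↑(t (l + 1))⁻¹ * (p j).quad))), 0⟩
    have hw (j : Fin (n + 1)) :
        (w j.castSucc).const = σ.symm ((p j).lin l) ∧ (w j.castSucc).lin l = 0 := by
      cases j using Fin.cases with
      | zero => exact ⟨rfl, rfl⟩
      | succ j =>
        have hj : ↑α⁻¹ * (p j.castSucc).lin (l + 1) = (p j.succ).lin l := by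
          rw [hl, Units.inv_mul_cancel_left]
        rw [← Fin.succ_castSucc]
        exact ⟨congrArg σ.symm hj, Pi.single_eq_of_ne (by simp) _⟩
    refine ⟨w, ?_⟩
    ext j m
    · rw [const_differential, hc]
    · obtain rfl | rfl := zmod_two_eq_or_eq_add_one m l
      · rw [lin_differential, (hw j).1, AlgEquiv.apply_symm_apply]
      · rw [lin_add_one_differential]
        simp [w]
    · rw [quad_differential, (hw j).2]
      simp [w]

/-- The coefficients `αₙ` for which the maps `(pⱼ) ↦ (xₙ pⱼ + αₙ xₙ₊₁ pⱼ₊₁)` form a complex. -/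
def coeff (σ : R ≃ₐ[K] R) (t : ZMod 2 → Rˣ) : ℕ → Rˣ
  | 0 => 1
  | n + 1 => Units.mapEquiv (σ.symm : R ≃* R) (-((t n)⁻¹ * t (n + 1) * coeff σ t n))

theorem coeff_succ (n : ℕ) :
    (t n : R) * σ (coeff σ t (n + 1)) = -(t (n + 1) * coeff σ t n) := by
  simp [coeff, ← mul_assoc]

theorem exact_differential (n : ℕ) :
    Function.Exact (differential σ t (n + 2) ↑(n + 1) (coeff σ t (n + 1)))
      (differential σ t (n + 1) n (coeff σ t n)) := by
  intro p
  have add_two : ((n + 1 : ℕ) : ZMod 2) + 1 = n := by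
    rw [Nat.cast_succ, add_assoc, show (1 : ZMod 2) + 1 = 0 from rfl, add_zero]
  rw [differential_eq_zero_iff, mem_range_differential_iff, add_two]
  refine and_congr_right fun _ => forall_congr' fun j => ?_
  have coeff_mul (c : R) :
      t n * σ (coeff σ t (n + 1) * c) = -(t (n + 1) * (coeff σ t n * σ c)) := by
    rw [map_mul, ← mul_assoc, coeff_succ, neg_mul, mul_assoc]
  rw [Nat.cast_succ, add_eq_zero_iff_eq_neg, ← coeff_mul, Units.mul_right_inj, σ.injective.eq_iff]

theorem isKoszulAlgebra [FiniteDimensional K R] [IsSemisimpleRing R] :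
    IsKoszulAlgebra (grading σ t) := by
  let _ : Unique (Fin (0 + 1)) := inferInstanceAs (Unique (Fin 1))
  refine ⟨inferInstance, ⟨gradedAlgebra_grading, inferInstance⟩, _, _, _, _, _, _,
    isLinearResolution_of_free (ι := fun n => Fin (n + 1))
      (fun n => differential σ t (n + 1) n (coeff σ t n))
      (fun n k p hp i => add_mem (SetLike.mul_mem_graded (monomial_mem_grading _ _) (hp _))
        (SetLike.mul_mem_graded (monomial_mem_grading _ _) (hp _)))
      exact_differential (fun p => ?_)⟩
  rw [mem_jacobson_iff, mem_range_differential_iff]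
  simp [Fin.forall_fin_one]

end Resolution

end SkewQuadric

section Idempotents

variable {K : Type*} [Field K] {B : Type*} [Ring B] [Algebra K B] {ι : Type*} [Fintype ι]
  {e : ι → B} (he : CompleteOrthogonalIdempotents e)

/-- The homomorphism from `K × ⋯ × K` to an algebra that is given by the images of the standard
idempotents. -/
def piLift : (ι → K) →ₐ[K] B :=
  AlgHom.ofLinearMap (Fintype.linearCombination K e)
    (by simpa [Fintype.linearCombination_apply] using he.complete)
    (fun f g => by
      classical
      simp [Fintype.linearCombination_apply, Finset.sum_mul, Finset.mul_sum, he.mul_eq, smul_smul,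
        mul_comm])

theorem piLift_apply (g : ι → K) : piLift he g = ∑ i, g i • e i := rfl

theorem piLift_mul (g : ι → K) (i : ι) : piLift he g * e i = g i • e i := by
  classical
  simp [piLift_apply, Finset.sum_mul, he.mul_eq]

end Idempotents

namespace Gamma

variable {K : Type u} [Field K]

section Relations

theorem e_mul_x (i : ZMod 4) (l : ZMod 2) :
    e K i * x K l = PathAlgebra.arrow K (GammaArrow.a l i) := by
  rw [e, x, Finset.mul_sum, Finset.sum_eq_single i]
  · rw [PathAlgebra.vertex, PathAlgebra.arrow, PathAlgebra.ofPath_mul_ofPath_same,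
      Quiver.Path.nil_comp]
  · exact fun j _ h => PathAlgebra.ofPath_mul_ofPath_ne K _ _ h.symm
  · simp

theorem x_mul_e (i : ZMod 4) (l : ZMod 2) :
    x K l * e K (i + 1) = PathAlgebra.arrow K (GammaArrow.a l i) := by
  rw [e, x, Finset.sum_mul, Finset.sum_eq_single i]
  · rw [PathAlgebra.vertex, PathAlgebra.arrow, PathAlgebra.ofPath_mul_ofPath_same,
      Quiver.Path.comp_nil]
  · exact fun j _ h => PathAlgebra.ofPath_mul_ofPath_ne K _ _ fun h' => h (add_right_cancel h')
  · simp

variable (T : ℕ) (q : ZMod 4 → K)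

theorem proj_surjective : Function.Surjective (proj T q) :=
  Ideal.Quotient.mkₐ_surjective K _

theorem proj_eq_zero {r : KGamma K} (hr : r ∈ relations T q) : proj T q r = 0 :=
  Ideal.Quotient.eq_zero_iff_mem.2 (TwoSidedIdeal.mem_asIdeal.2 (TwoSidedIdeal.subset_span hr))

theorem completeOrthogonalIdempotents_proj_e :
    CompleteOrthogonalIdempotents fun i => proj T q (e K i) :=
  (PathAlgebra.completeOrthogonalIdempotents_vertex K GammaVertex).map (proj T q).toRingHom

variable {T q} {B : Type*} [Ring B] [Algebra K B]

/-- The homomorphism from `A_T(q₀, q₁, q₂, q₃)` that is induced by a homomorphism from `KΓ` that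
kills the relations. -/
def AlgebraA.lift (φ : KGamma K →ₐ[K] B) (hφ : ∀ r ∈ relations T q, φ r = 0) :
    AlgebraA T q →ₐ[K] B :=
  Ideal.Quotient.liftₐ _ φ fun _ ha =>
    (TwoSidedIdeal.mem_ker φ).1 <| TwoSidedIdeal.span_le.2
      (fun r hr => (TwoSidedIdeal.mem_ker φ).2 (hφ r hr)) (TwoSidedIdeal.mem_asIdeal.1 ha)

theorem AlgebraA.lift_proj (φ : KGamma K →ₐ[K] B) (hφ : ∀ r ∈ relations T q, φ r = 0)
    (y : KGamma K) : AlgebraA.lift φ hφ (proj T q y) = φ y := rfl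

theorem AlgebraA.algHom_ext {φ ψ : AlgebraA T q →ₐ[K] B}
    (he : ∀ i, φ (proj T q (e K i)) = ψ (proj T q (e K i)))
    (hx : ∀ l, φ (proj T q (x K l)) = ψ (proj T q (x K l))) : φ = ψ := by
  refine Ideal.Quotient.algHom_ext K (PathAlgebra.algHom_ext he ?_)
  rintro m _ ⟨l, _⟩
  change φ (proj T q (PathAlgebra.arrow K (GammaArrow.a l m))) =
    ψ (proj T q (PathAlgebra.arrow K (GammaArrow.a l m)))
  rw [← e_mul_x, map_mul, map_mul, map_mul, he, hx]

end Relations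

section Model

variable (K) in
/-- The automorphism of `K × K × K × K` with `xₗ g = shift g xₗ`. -/
def shift : (ZMod 4 → K) ≃ₐ[K] (ZMod 4 → K) :=
  AlgEquiv.piCongrLeft' K (fun _ => K) (Equiv.subRight 1)

theorem shift_apply (g : ZMod 4 → K) (i : ZMod 4) : shift K g i = g (i + 1) := rfl

/-- The coefficients with `eᵢ xₗ ² = squareCoeff hq l i • eᵢ xᵢ ²` in `A₀(q₀, q₁, q₂, q₃)`. -/
def squareCoeff {q : ZMod 4 → K} (hq : ∀ i, q i ≠ 0) (l : ZMod 2) : (ZMod 4 → K)ˣ :=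
  MulEquiv.piUnits.symm fun i => if l = mod2 i then 1 else -Units.mk0 (q i) (hq i)

theorem squareCoeff_apply {q : ZMod 4 → K} (hq : ∀ i, q i ≠ 0) (l : ZMod 2) (i : ZMod 4) :
    (squareCoeff hq l : ZMod 4 → K) i = if l = mod2 i then 1 else -q i := by
  simp only [squareCoeff, MulEquiv.val_piUnits_symm_apply]
  split_ifs <;> rfl

variable {q : ZMod 4 → K} (hq : ∀ i, q i ≠ 0)

/-- The model of `A₀(q₀, q₁, q₂, q₃)`: the skew algebra over `K × K × K × K` with `xₗ² = tₗ s`,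
where `s = ∑ᵢ eᵢ xᵢ²`. -/
abbrev Model : Type u := SkewQuadric (shift K) (squareCoeff hq)

theorem completeOrthogonalIdempotents_ofConst :
    CompleteOrthogonalIdempotents
      fun i : ZMod 4 => (SkewQuadric.ofConst (Pi.single i 1) : Model hq) :=
  (CompleteOrthogonalIdempotents.single fun _ : ZMod 4 => K).map
    (SkewQuadric.ofConst : (ZMod 4 → K) →ₐ[K] Model hq).toRingHom

/-- The images of the arrows in the model. -/
def arrowValue : ∀ {i j : GammaVertex}, (i ⟶ j) → Model hq
  | _, _, .a l _ => SkewQuadric.monomial _ _ l 1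

/-- The homomorphism from the path algebra to the model. -/
def pathToModel : KGamma K →ₐ[K] Model hq :=
  PathAlgebra.lift (completeOrthogonalIdempotents_ofConst hq) (arrowValue hq)

theorem pathToModel_e (i : ZMod 4) :
    pathToModel hq (e K i) = SkewQuadric.ofConst (Pi.single i 1) :=
  PathAlgebra.lift_vertex _ _ i

theorem pathToModel_x (l : ZMod 2) :
    pathToModel hq (x K l) = SkewQuadric.monomial _ _ l 1 := by
  have he := completeOrthogonalIdempotents_ofConst hq
  have shift_single (m : ZMod 4) : shift K (Pi.single (m + 1) 1) = Pi.single m 1 := by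
    ext j
    simp [shift_apply, Pi.single_apply]
  have map_arrow (m : ZMod 4) : pathToModel hq (PathAlgebra.arrow K (GammaArrow.a l m)) =
      SkewQuadric.ofConst (Pi.single m 1) * SkewQuadric.monomial _ _ l 1 := by
    refine (PathAlgebra.lift_arrow he (arrowValue hq) (GammaArrow.a l m)).trans ?_
    rw [arrowValue, SkewQuadric.monomial_one_mul_ofConst, shift_single, ← mul_assoc,
      (he.idem m).eq]
  simp only [x, map_sum, map_arrow]
  rw [← Finset.sum_mul, he.complete, one_mul]

theorem pathToModel_relations (r : KGamma K) (hr : r ∈ relations 0 q) : pathToModel hq r = 0 := by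
  rcases hr with ⟨l, rfl⟩ | ⟨i, rfl⟩
  · rw [map_mul, pathToModel_x, pathToModel_x, SkewQuadric.monomial_mul_monomial_of_ne (by simp)]
  · simp only [map_mul, map_add, map_smul, pathToModel_x, pathToModel_e, mul_zero, zero_add,
      pow_two, SkewQuadric.monomial_mul_monomial_self, SkewQuadric.ofConst_mul]
    ext j
    · simp
    · simp
    · rcases eq_or_ne j i with rfl | hj
      · simp [squareCoeff_apply]
      · simp [hj]

/-- The homomorphism from `A₀(q₀, q₁, q₂, q₃)` to the model. -/
def toModel : AlgebraA 0 q →ₐ[K] Model hq :=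
  AlgebraA.lift (pathToModel hq) (pathToModel_relations hq)

theorem toModel_proj (y : KGamma K) : toModel hq (proj 0 q y) = pathToModel hq y :=
  AlgebraA.lift_proj _ _ y

theorem e_mul_x_mul_x (i : ZMod 4) (l : ZMod 2) :
    proj 0 q (e K i * (x K l * x K l)) =
      (squareCoeff hq l : ZMod 4 → K) i • proj 0 q (e K i * (x K (mod2 i) * x K (mod2 i))) := by
  have h := proj_eq_zero 0 q (Or.inr ⟨i, rfl⟩)
  simp only [mul_zero, zero_add, pow_two, mul_add, mul_smul_comm, map_add, map_smul] at h
  rw [squareCoeff_apply]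
  obtain rfl | rfl := zmod_two_eq_or_eq_add_one l (mod2 i)
  · rw [if_pos rfl, one_smul]
  · rw [if_neg (by simp), neg_smul]
    exact eq_neg_of_add_eq_zero_right h

theorem isSystem_x :
    SkewQuadric.IsSystem (shift K) (squareCoeff hq)
      (piLift (completeOrthogonalIdempotents_proj_e 0 q)) (fun l => proj 0 q (x K l))
      (∑ i, proj 0 q (e K i * (x K (mod2 i) * x K (mod2 i)))) where
  comm l g := by
    simp only [piLift_apply, Finset.sum_mul, Finset.mul_sum, shift_apply, mul_smul_comm,
      smul_mul_assoc, ← map_mul]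
    refine (Equiv.sum_comp (Equiv.addRight (1 : ZMod 4)) _).symm.trans ?_
    simp only [Equiv.coe_addRight, x_mul_e, e_mul_x]
  ortho l m h := by
    obtain rfl | rfl := zmod_two_eq_or_eq_add_one m l
    · exact absurd rfl h
    · rw [← map_mul]
      exact proj_eq_zero 0 q (Or.inl ⟨l, rfl⟩)
  sq l := by
    have he := completeOrthogonalIdempotents_proj_e 0 q
    have hl (i : ZMod 4) : piLift he (squareCoeff hq l : ZMod 4 → K) *
        proj 0 q (e K i * (x K (mod2 i) * x K (mod2 i))) =
          proj 0 q (e K i) * proj 0 q (x K l * x K l) := by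
      rw [map_mul, ← mul_assoc, piLift_mul, smul_mul_assoc, ← map_mul, ← map_mul,
        e_mul_x_mul_x hq i l]
    rw [Finset.mul_sum, Finset.sum_congr rfl fun i _ => hl i, ← Finset.sum_mul, he.complete,
      one_mul, map_mul]

/-- The homomorphism from the model to `A₀(q₀, q₁, q₂, q₃)`. -/
def ofModel : Model hq →ₐ[K] AlgebraA 0 q := (isSystem_x hq).lift

theorem ofModel_monomial (l : ZMod 2) :
    ofModel hq (SkewQuadric.monomial _ _ l 1) = proj 0 q (x K l) := by
  rw [ofModel, SkewQuadric.IsSystem.lift_monomial, map_one, one_mul]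

theorem ofModel_ofConst (g : ZMod 4 → K) :
    ofModel hq (SkewQuadric.ofConst g) = ∑ i, g i • proj 0 q (e K i) :=
  (isSystem_x hq).lift_ofConst g

/-- The isomorphism of the model with `A₀(q₀, q₁, q₂, q₃)`. -/
def modelEquiv : Model hq ≃ₐ[K] AlgebraA 0 q :=
  AlgEquiv.ofAlgHom (ofModel hq) (toModel hq)
    (AlgebraA.algHom_ext
      (fun i => by
        simp [toModel_proj, pathToModel_e, ofModel_ofConst, Pi.single_apply])
      (fun l => by
        simp [toModel_proj, pathToModel_x, ofModel_monomial]))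
    (SkewQuadric.algHom_ext
      (fun g => by
        simp only [AlgHom.comp_apply, ofModel_ofConst, map_sum, map_smul, toModel_proj,
          pathToModel_e]
        simp only [← map_smul, ← map_sum, AlgHom.id_apply]
        exact congrArg _ (pi_eq_sum_univ' g).symm)
      (fun l => by
        simp [toModel_proj, pathToModel_x, ofModel_monomial]))

theorem lengthGrading_eq_mapGrading :
    lengthGrading 0 q =
      mapGrading (SkewQuadric.grading (shift K) (squareCoeff hq)) (modelEquiv hq) := by
  refine (iSupIndep.le_iff_eq_of_iSup_eq_top
    (isInternal_mapGrading _ _).submodule_iSupIndep ?_).1 fun n => ?_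
  · change ⨆ n, (PathAlgebra.lengthComponent K GammaVertex n).map (proj 0 q).toLinearMap = ⊤
    rw [← Submodule.map_iSup, PathAlgebra.iSup_lengthComponent, Submodule.map_top,
      LinearMap.range_eq_top]
    exact proj_surjective 0 q
  · refine Submodule.map_le_iff_le_comap.2 (Submodule.span_le.2 ?_)
    rintro _ ⟨a, b, p, rfl, rfl⟩
    refine ⟨toModel hq (proj 0 q (PathAlgebra.ofPath K p)), ?_, (modelEquiv hq).apply_symm_apply _⟩
    rw [toModel_proj, pathToModel, PathAlgebra.lift_ofPath]
    refine PathAlgebra.pathValue_mem_graded (fun i => ?_) ?_ p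
    · simp [SkewQuadric.mem_grading, SkewQuadric.ofConst]
    · rintro _ _ ⟨l, _⟩
      exact SkewQuadric.monomial_mem_grading l 1

end Model

end Gamma

theorem proposition2p2_general {K : Type u} [Field K] (q : ZMod 4 → K) (hq : ∀ i, q i ≠ 0) :
    IsSelfInjectiveAlgebra K (Gamma.AlgebraA 0 q) ∧
      IsKoszulAlgebra (Gamma.lengthGrading 0 q) := by
  let τ : (ZMod 4 → K) →ₗ[K] K := ∑ i, LinearMap.proj i
  have hτ (c : ZMod 4 → K) (hc : ∀ b, τ (b * c) = 0) : c = 0 :=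
    funext fun i => by simpa [τ, Pi.single_apply] using hc (Pi.single i 1)
  exact ⟨.of_algEquiv (Gamma.modelEquiv hq) (SkewQuadric.isSelfInjectiveAlgebra τ hτ),
    Gamma.lengthGrading_eq_mapGrading hq ▸ SkewQuadric.isKoszulAlgebra.map (Gamma.modelEquiv hq)⟩

end

theorem proposition2p2 {K : Type u} [Field K] [IsAlgClosed K] (q : ZMod 4 → K)
    (hq : ∀ i, q i ≠ 0) :
    IsSelfInjectiveAlgebra K (Gamma.AlgebraA 0 q) ∧
      IsKoszulAlgebra (Gamma.lengthGrading 0 q) :=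
  proposition2p2_general q hq
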